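/- Let $\mathfrak R=(R,0,1,+,\cdot,<,\dots)$ be an expansion of an ordered field $R$; "definable" means definable in $\mathfrak R$, possibly with parameters. Assume that $\mathfrak R$ is definably complete: every non-empty definable subset of $R$ which is bounded from above has a least upper bound in $R$. Let $n\in\mathbb N$, write $\langle\cdot,\cdot\rangle$ for the dot product on each $R^m$, put $\|x\|^2=\langle x,x\rangle$, and let $R_{\pm\infty}=R\cup\{-\infty,+\infty\}$. A set-valued map $T\colon R^n\rightrightarrows R^n$ assigns to each $x\in R^n$ a subset $T(x)$ of $R^n$; its graph is $\{(x,x^*)\in R^n\times R^n: x^*\in T(x)\}$. It is non-trivial if its graph is non-empty, and definable if its graph is definable. A pair $(x,x^*)$ is monotonically related to $T$ if $\langle x-y,x^*-y^*\rangle\ge 0$ for all $(y,y^*)$ in the graph of $T$. The map $T$ is monotone if every element of its graph is monotonically related to $T$, and maximal monotone if moreover every $(x,x^*)$ monotonically related to $T$ belongs to its graph. A set-valued map extends $T$ if its graph contains the graph of $T$. The set-valued map represented by a function $f\colon R^n\times R^n\to R_{\pm\infty}$ is the one with graph $\{(x,x^*): f(x,x^*)=\langle x,x^*\rangle\}$.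 **Proposition.** Let $T\colon R^n\rightrightarrows R^n$ be a non-trivial definable monotone set-valued map. For $\tilde x=(x,x^*)$ and $\tilde y$ in $R^n\times R^n$ put $\tilde x^{\mathrm t}=(x^*,x)$, $$\Phi_T(x,x^*)=\sup\big\{\langle x,a^*\rangle+\langle a,x^*\rangle-\langle a,a^*\rangle : a^*\in T(a)\big\},$$ $$\Phi_T^*(\tilde y)=\sup_{\tilde x\in R^n\times R^n}\big(\langle\tilde x,\tilde y\rangle-\Phi_T(\tilde x)\big),$$ $$\Psi_T(\tilde x)=\inf_{\tilde y+\tilde z=2\tilde x}\Big(\tfrac12\Phi_T(\tilde y)+\tfrac12\Phi_T^*(\tilde z^{\mathrm t})+\tfrac18\|\tilde y-\tilde z\|^2\Big)$$ (the Fitzpatrick function of $T$, its Fenchel conjugate, and the proximal average of $\Phi_T$ and the transpose of $\Phi_T^*$). These suprema and infima exist in $R_{\pm\infty}$, and the set-valued map represented by $\Psi_T$ is definable, maximal monotone, and extends $T$. -/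

import Mathlib

universe u v w

namespace DefinableConvex

open FirstOrder.Language

/-- The structure on `R` expands the ordered field `(R, 0, 1, +, ·, <)`: the language has symbols
which are interpreted by `0`, `1`, `+`, `·` and `<`. -/
structure IsOrderedFieldExpansion (L : FirstOrder.Language.{u, v}) (R : Type w) [Field R] [LinearOrder R]
    [L.Structure R] : Prop where
  zero : ∃ c : L.Functions 0, ∀ x : Fin 0 → R, Structure.funMap c x = 0
  one : ∃ c : L.Functions 0, ∀ x : Fin 0 → R, Structure.funMap c x = 1
  add : ∃ f : L.Functions 2, ∀ x : Fin 2 → R, Structure.funMap f x = x 0 + x 1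
  mul : ∃ f : L.Functions 2, ∀ x : Fin 2 → R, Structure.funMap f x = x 0 * x 1
  lt : ∃ r : L.Relations 2, ∀ x : Fin 2 → R, Structure.RelMap r x ↔ x 0 < x 1

/-- Definable completeness: every non-empty subset of `R` which is definable (with parameters) and
bounded from above has a least upper bound in `R`. -/
def DefinablyComplete (L : FirstOrder.Language.{u, v}) (R : Type w) [LinearOrder R] [L.Structure R] : Prop :=
  ∀ S : Set R, (Set.univ : Set R).Definable₁ L S → S.Nonempty → BddAbove S → ∃ b, IsLUB S b

/-! ### Extended values -/

/-- The linearly ordered set `R ∪ {-∞, +∞}`. -/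
abbrev Ext (R : Type w) : Type w := WithBot (WithTop R)

/-- The inclusion of `R` into `R ∪ {-∞, +∞}`. -/
def toExt {R : Type w} (r : R) : Ext R := ((r : WithTop R) : WithBot (WithTop R))

/-- The difference `r - a` of an element `r` of `R` and an extended element `a`:
`r - (+∞) = -∞` and `r - (-∞) = +∞`. -/
def subExt {R : Type w} [Sub R] (r : R) : Ext R → Ext R
  | none => ⊤
  | some none => ⊥
  | some (some a) => toExt (r - a)

/-- The product `c a` of a positive element `c` of `R` and an extended element `a`:
`c (+∞) = +∞` and `c (-∞) = -∞`. -/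
def scaleExt {R : Type w} [Mul R] (c : R) : Ext R → Ext R
  | none => ⊥
  | some none => ⊤
  | some (some a) => toExt (c * a)

open Classical in
/-- The supremum in `R ∪ {-∞, +∞}` of a set which has one (the value is irrelevant otherwise). -/
noncomputable def supExt {R : Type w} [LinearOrder R] (S : Set (Ext R)) : Ext R :=
  if h : ∃ b, IsLUB S b then h.choose else ⊥

open Classical in
/-- The infimum in `R ∪ {-∞, +∞}` of a set which has one (the value is irrelevant otherwise). -/
noncomputable def infExt {R : Type w} [LinearOrder R] (S : Set (Ext R)) : Ext R :=
  if h : ∃ b, IsGLB S b then h.choose else ⊤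

section Functions

variable {R : Type w} [Field R] [LinearOrder R] {ι : Type*} [Fintype ι]

/-- The terms `⟨x, y⟩ - f x` of the supremum that defines the conjugate of `f` at `y`. -/
def conjugateTerms (f : (ι → R) → Ext R) (y : ι → R) : Set (Ext R) :=
  Set.range fun x : ι → R => subExt (x ⬝ᵥ y) (f x)

/-- The Fenchel conjugate `f*` of `f`. -/
noncomputable def conjugate (f : (ι → R) → Ext R) (y : ι → R) : Ext R :=
  supExt (conjugateTerms f y)

/-- `κ (y, z) = ½ ‖y - z‖²`. -/
def kappa (y z : ι → R) : R := 1 / 2 * ((y - z) ⬝ᵥ (y - z))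

/-- The terms `½ f y + ½ g z + ¼ κ (y, z)`, with `y + z = 2 x`, of the infimum that defines the
proximal average of `f` and `g` at `x`. -/
def proximalTerms (f g : (ι → R) → Ext R) (x : ι → R) : Set (Ext R) :=
  {t | ∃ y z : ι → R, y + z = (2 : R) • x ∧
    t = scaleExt (1 / 2) (f y) + scaleExt (1 / 2) (g z) + toExt (1 / 4 * kappa y z)}

/-- The proximal average of `f` and `g`. -/
noncomputable def proximalAverage (f g : (ι → R) → Ext R) (x : ι → R) : Ext R :=
  infExt (proximalTerms f g x)

end Functions

/-! ### Set-valued maps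

A set-valued map from `Rⁿ` to `Rⁿ` is a function `T : (Fin n → R) → Set (Fin n → R)`.
The space `Rⁿ × Rⁿ` is written as `Fin n ⊕ Fin n → R`: the pair `(x, x*)` is `Sum.elim x x*`, and
the two components of `v` are `v ∘ Sum.inl` and `v ∘ Sum.inr`. -/

section SetValued

variable {R : Type w} {n : ℕ}

/-- The transpose of `f`: `(x, x*) ↦ f (x*, x)`. -/
def transpose (f : (Fin n ⊕ Fin n → R) → Ext R) (v : Fin n ⊕ Fin n → R) : Ext R :=
  f (Sum.elim (v ∘ Sum.inr) (v ∘ Sum.inl))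

/-- The graph of a set-valued map, as a subset of `Rⁿ × Rⁿ`. -/
def graph (T : (Fin n → R) → Set (Fin n → R)) : Set (Fin n ⊕ Fin n → R) :=
  {v | v ∘ Sum.inr ∈ T (v ∘ Sum.inl)}

/-- A set-valued map is definable (with parameters) if its graph is. -/
def IsDefinableMap (L : FirstOrder.Language.{u, v}) [L.Structure R]
    (T : (Fin n → R) → Set (Fin n → R)) : Prop :=
  (Set.univ : Set R).Definable L (graph T)

/-- A set-valued map is trivial if all its values are empty. -/
def IsTrivial (T : (Fin n → R) → Set (Fin n → R)) : Prop :=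
  ∀ x, T x = ∅

/-- `S` extends `T`. -/
def Extends (S T : (Fin n → R) → Set (Fin n → R)) : Prop :=
  graph T ⊆ graph S

variable [Field R] [LinearOrder R]

/-- `(x, x*)` is monotonically related to `T`. -/
def MonotonicallyRelated (T : (Fin n → R) → Set (Fin n → R)) (x x' : Fin n → R) : Prop :=
  ∀ y y' : Fin n → R, y' ∈ T y → 0 ≤ (x - y) ⬝ᵥ (x' - y')

/-- Monotone set-valued maps. -/
def IsMonotone (T : (Fin n → R) → Set (Fin n → R)) : Prop :=
  ∀ x x' : Fin n → R, x' ∈ T x → MonotonicallyRelated T x x'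

/-- Maximal monotone set-valued maps. -/
def IsMaximalMonotone (T : (Fin n → R) → Set (Fin n → R)) : Prop :=
  IsMonotone T ∧ ∀ x x' : Fin n → R, MonotonicallyRelated T x x' → x' ∈ T x

/-- The set-valued map represented by `f`: its graph consists of all `(x, x*)` with
`f (x, x*) = ⟨x, x*⟩`. -/
def representedBy (f : (Fin n ⊕ Fin n → R) → Ext R) : (Fin n → R) → Set (Fin n → R) :=
  fun x => {x' | f (Sum.elim x x') = toExt (x ⬝ᵥ x')}

/-- The terms `⟨x, a*⟩ + ⟨a, x*⟩ - ⟨a, a*⟩`, with `(a, a*)` in the graph of `T`, of the supremum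
that defines the Fitzpatrick function of `T` at `v = (x, x*)`. -/
def fitzpatrickTerms (T : (Fin n → R) → Set (Fin n → R)) (v : Fin n ⊕ Fin n → R) : Set (Ext R) :=
  {t | ∃ a a' : Fin n → R, a' ∈ T a ∧
    t = toExt ((v ∘ Sum.inl) ⬝ᵥ a' + a ⬝ᵥ (v ∘ Sum.inr) - a ⬝ᵥ a')}

/-- The Fitzpatrick function of `T`. -/
noncomputable def fitzpatrick (T : (Fin n → R) → Set (Fin n → R)) (v : Fin n ⊕ Fin n → R) :
    Ext R :=
  supExt (fitzpatrickTerms T v)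

/-- The function `Ψ_T`: the proximal average of the Fitzpatrick function of `T` and the transpose
of its conjugate. -/
noncomputable def psi (T : (Fin n → R) → Set (Fin n → R)) : (Fin n ⊕ Fin n → R) → Ext R :=
  proximalAverage (fitzpatrick T) (transpose (conjugate (fitzpatrick T)))

end SetValued

end DefinableConvex

namespace DefinableConvex

open FirstOrder.Language

/-! ### Definability in expansions of ordered fields -/

section Logic

variable {L : FirstOrder.Language.{u, v}} {R : Type w} [L.Structure R] {α β : Type*}

/-! Write `G` for the graph of `T` and `dual` for the duality product. Extended values are traded
for first-order conditions on bounds in `R`: `FitzpatrickLE`, `ConjugateLE` and `LEPsi` describe the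
epigraphs of `Φ_T` and `Φ_T*` and the hypograph of `Ψ_T`. These conditions are definable, so
definable completeness supplies all suprema and infima.

Fenchel–Young and `2 * dual ≤ ‖·‖²` give `Ψ_T ≥ dual` everywhere (`lePsi_dual`), so the represented
map is the definable set `Ψ_T ≤ dual`. It contains `G`, because monotonicity gives `Φ_T ≤ dual` on
`G`. It is monotone, because `Ψ_T` is convex and `dual` is a quadratic form below it
(`dual_sub_nonneg_of_lePsi`).

For maximality (`mem_of_monotonicallyRelated`), let `w` be monotonically related to the represented
map. The proximal point `w + u` of `Φ_T` at `w + swap w` yields the point `v = w + ½ (u - swap u)`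
of the graph. Since `swap` negates `u - swap u`, `dual (w - v)` equals `-⅛ ‖u - swap u‖²`. It is
also nonnegative, so `v = w`. In the absence of Cauchy completeness, the proximal point is built
coordinatewise from suprema of definable sets (`exists_minimizer`). -/

theorem definableFun_const (a : R) : (Set.univ : Set R).DefinableFun L fun _ : α → R => a :=
  FirstOrder.Language.definableFun_const L α (Set.mem_univ a)

theorem definable_not {P : (α → R) → Prop} (h : (Set.univ : Set R).Definable L {x | P x}) :
    (Set.univ : Set R).Definable L {x | ¬ P x} :=
  h.compl

theorem definable_and {P Q : (α → R) → Prop} (hP : (Set.univ : Set R).Definable L {x | P x})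
    (hQ : (Set.univ : Set R).Definable L {x | Q x}) :
    (Set.univ : Set R).Definable L {x | P x ∧ Q x} :=
  hP.inter hQ

theorem definable_imp {P Q : (α → R) → Prop} (hP : (Set.univ : Set R).Definable L {x | P x})
    (hQ : (Set.univ : Set R).Definable L {x | Q x}) :
    (Set.univ : Set R).Definable L {x | P x → Q x} := by
  simpa [imp_iff_not_or] using! (definable_not hP).union hQ

theorem definable_forall [Finite β] {P : (α → R) → (β → R) → Prop}
    (h : (Set.univ : Set R).Definable L
      {z : α ⊕ β → R | P (fun i => z (Sum.inl i)) (fun i => z (Sum.inr i))}) :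
    (Set.univ : Set R).Definable L {x | ∀ y, P x y} := by
  simpa using! h.forall_of_finite

theorem definable_exists [Finite β] {P : (α → R) → (β → R) → Prop}
    (h : (Set.univ : Set R).Definable L
      {z : α ⊕ β → R | P (fun i => z (Sum.inl i)) (fun i => z (Sum.inr i))}) :
    (Set.univ : Set R).Definable L {x | ∃ y, P x y} := by
  simpa using! h.exists_of_finite

theorem definable_forall_elem {P : (α → R) → R → Prop}
    (h : (Set.univ : Set R).Definable L
      {z : α ⊕ Unit → R | P (fun i => z (Sum.inl i)) (z (Sum.inr ()))}) :
    (Set.univ : Set R).Definable L {x | ∀ y, P x y} := by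
  have := definable_forall (P := fun x (y : Unit → R) => P x (y ())) h
  simpa only [(Equiv.funUnique Unit R).surjective.forall,
    Equiv.funUnique_apply] using! this

theorem definable_exists_elem {P : (α → R) → R → Prop}
    (h : (Set.univ : Set R).Definable L
      {z : α ⊕ Unit → R | P (fun i => z (Sum.inl i)) (z (Sum.inr ()))}) :
    (Set.univ : Set R).Definable L {x | ∃ y, P x y} := by
  have := definable_exists (P := fun x (y : Unit → R) => P x (y ())) h
  simpa only [(Equiv.funUnique Unit R).surjective.exists, Equiv.funUnique_apply] using! this

end Logic

namespace IsOrderedFieldExpansion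

variable {L : FirstOrder.Language.{u, v}} {R : Type w} [Field R] [LinearOrder R] [L.Structure R]
  {α β : Type*}

theorem definableFun_add (hL : IsOrderedFieldExpansion L R) {f g : (α → R) → R}
    (hf : (Set.univ : Set R).DefinableFun L f) (hg : (Set.univ : Set R).DefinableFun L g) :
    (Set.univ : Set R).DefinableFun L fun x => f x + g x := by
  obtain ⟨c, hc⟩ := hL.add
  have h : (Set.univ : Set R).DefinableFun L fun x : Fin 2 → R => x 0 + x 1 := by
    have := Set.DefinableFun.fun_symbol (M := R) c
    simp only [funext hc] at this
    exact Set.DefinableFun.of_empty this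
  have hm : (Set.univ : Set R).DefinableMap L fun x => ![f x, g x] := by
    intro i; fin_cases i <;> simpa
  simpa using Set.DefinableFun.comp hm h

theorem definableFun_mul (hL : IsOrderedFieldExpansion L R) {f g : (α → R) → R}
    (hf : (Set.univ : Set R).DefinableFun L f) (hg : (Set.univ : Set R).DefinableFun L g) :
    (Set.univ : Set R).DefinableFun L fun x => f x * g x := by
  obtain ⟨c, hc⟩ := hL.mul
  have h : (Set.univ : Set R).DefinableFun L fun x : Fin 2 → R => x 0 * x 1 := by
    have := Set.DefinableFun.fun_symbol (M := R) c
    simp only [funext hc] at this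
    exact Set.DefinableFun.of_empty this
  have hm : (Set.univ : Set R).DefinableMap L fun x => ![f x, g x] := by
    intro i; fin_cases i <;> simpa
  simpa using Set.DefinableFun.comp hm h

theorem definableFun_sub (hL : IsOrderedFieldExpansion L R) {f g : (α → R) → R}
    (hf : (Set.univ : Set R).DefinableFun L f) (hg : (Set.univ : Set R).DefinableFun L g) :
    (Set.univ : Set R).DefinableFun L fun x => f x - g x := by
  simpa [sub_eq_add_neg] using
    hL.definableFun_add hf (hL.definableFun_mul (definableFun_const (-1)) hg)

theorem definableFun_sum (hL : IsOrderedFieldExpansion L R) {ι : Type*} (s : Finset ι)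
    {f : ι → (α → R) → R} (hf : ∀ i, (Set.univ : Set R).DefinableFun L (f i)) :
    (Set.univ : Set R).DefinableFun L fun x => ∑ i ∈ s, f i x := by
  classical
  induction s using Finset.induction_on with
  | empty => simpa using definableFun_const (0 : R)
  | insert i s hi ih => simpa [Finset.sum_insert hi] using hL.definableFun_add (hf i) ih

theorem definableFun_dotProduct (hL : IsOrderedFieldExpansion L R) {ι : Type*} [Fintype ι]
    {F G : (α → R) → ι → R} (hF : (Set.univ : Set R).DefinableMap L F)
    (hG : (Set.univ : Set R).DefinableMap L G) :
    (Set.univ : Set R).DefinableFun L fun x => F x ⬝ᵥ G x :=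
  hL.definableFun_sum _ fun i => hL.definableFun_mul (hF i) (hG i)

theorem definable_lt (hL : IsOrderedFieldExpansion L R) {f g : (α → R) → R}
    (hf : (Set.univ : Set R).DefinableFun L f) (hg : (Set.univ : Set R).DefinableFun L g) :
    (Set.univ : Set R).Definable L {x | f x < g x} := by
  obtain ⟨r, hr⟩ := hL.lt
  have h : (Set.univ : Set R).Definable L {x : Fin 2 → R | x 0 < x 1} := by
    refine Set.Definable.mono (A := ∅) (Set.empty_definable_iff.2
      ⟨r.formula (fun i => FirstOrder.Language.Term.var i), ?_⟩) (Set.empty_subset _)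
    ext x
    simp [← hr, FirstOrder.Language.Formula.realize_rel]
  have hm : (Set.univ : Set R).DefinableMap L fun x => ![f x, g x] := by
    intro i; fin_cases i <;> simpa
  simpa using! h.preimage_map hm

theorem definable_le (hL : IsOrderedFieldExpansion L R) {f g : (α → R) → R}
    (hf : (Set.univ : Set R).DefinableFun L f) (hg : (Set.univ : Set R).DefinableFun L g) :
    (Set.univ : Set R).Definable L {x | f x ≤ g x} := by
  simpa using! definable_not (hL.definable_lt hg hf)

end IsOrderedFieldExpansion

/-! ### Suprema and infima in `R ∪ {-∞, +∞}` -/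

section Order

variable {R : Type w} [LinearOrder R]

@[simp] theorem toExt_le_toExt {a b : R} : toExt a ≤ toExt b ↔ a ≤ b := by
  simp [toExt]

theorem Ext.cases {R : Type w} (x : Ext R) : x = ⊥ ∨ x = ⊤ ∨ ∃ r, x = toExt r := by
  rcases x with _ | _ | r
  · exact .inl rfl
  · exact .inr (.inl rfl)
  · exact .inr (.inr ⟨r, rfl⟩)

theorem not_top_le_toExt (a : R) : ¬ (⊤ : Ext R) ≤ toExt a := by
  simp [toExt, WithBot.coe_eq_top]

theorem not_toExt_le_bot (a : R) : ¬ toExt a ≤ (⊥ : Ext R) := by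
  simp [toExt]

theorem isLUB_supExt {S : Set (Ext R)} (h : ∃ b, IsLUB S b) : IsLUB S (supExt S) := by
  rw [supExt, dif_pos h]
  exact h.choose_spec

theorem isGLB_infExt {S : Set (Ext R)} (h : ∃ b, IsGLB S b) : IsGLB S (infExt S) := by
  rw [infExt, dif_pos h]
  exact h.choose_spec

end Order

section Ext

variable {L : FirstOrder.Language.{u, v}} {R : Type w} [Field R] [LinearOrder R] [L.Structure R]

theorem DefinablyComplete.exists_isGLB (hL : IsOrderedFieldExpansion L R)
    (hR : DefinablyComplete L R) {S : Set R} (hS : (Set.univ : Set R).Definable₁ L S)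
    (hne : S.Nonempty) (hbdd : BddBelow S) : ∃ b, IsGLB S b := by
  have hdef : (Set.univ : Set R).Definable₁ L (lowerBounds S) := by
    unfold Set.Definable₁
    refine definable_forall_elem
      (P := fun (x : Fin 1 → R) y => y ∈ S → x 0 ≤ y)
      (definable_imp ?_ (hL.definable_le (.proj _) (.proj _)))
    exact Set.Definable.preimage_comp (fun _ => Sum.inr ()) hS
  obtain ⟨b, hb⟩ := hR _ hdef hbdd (hne.mono fun x hx y hy => hy hx)
  exact ⟨b, isLUB_lowerBounds.1 hb⟩

variable [IsStrictOrderedRing R]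

theorem Ext.ext_iff_ge {x y : Ext R} : x = y ↔ ∀ r : R, toExt r ≤ x ↔ toExt r ≤ y := by
  refine ⟨by rintro rfl; simp, fun h => ?_⟩
  rcases Ext.cases x with rfl | rfl | ⟨a, rfl⟩ <;> rcases Ext.cases y with rfl | rfl | ⟨b, rfl⟩
  · rfl
  · exact absurd ((h 0).2 le_top) (not_toExt_le_bot _)
  · exact absurd ((h b).2 le_rfl) (not_toExt_le_bot _)
  · exact absurd ((h 0).1 le_top) (not_toExt_le_bot _)
  · rfl
  · have := toExt_le_toExt.1 ((h (b + 1)).1 le_top)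
    linarith
  · exact absurd ((h a).1 le_rfl) (not_toExt_le_bot _)
  · have := toExt_le_toExt.1 ((h (a + 1)).2 le_top)
    linarith
  · rw [le_antisymm (toExt_le_toExt.1 ((h a).1 le_rfl)) (toExt_le_toExt.1 ((h b).2 le_rfl))]

/-- The upper bounds lying in `R` decide the supremum: it is `⊤` if there are none, `⊥` if they are
unbounded below, and otherwise their infimum. -/
theorem exists_isLUB_of_definable (hL : IsOrderedFieldExpansion L R)
    (hR : DefinablyComplete L R) (S : Set (Ext R))
    (hS : (Set.univ : Set R).Definable₁ L {r | toExt r ∈ upperBounds S}) : ∃ b, IsLUB S b := by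
  by_cases hne : {r : R | toExt r ∈ upperBounds S}.Nonempty
  · by_cases hbdd : BddBelow {r : R | toExt r ∈ upperBounds S}
    · obtain ⟨b, hb⟩ := hR.exists_isGLB hL hS hne hbdd
      refine ⟨toExt b, fun x hx => ?_, fun x hx => ?_⟩
      · rcases Ext.cases x with rfl | rfl | ⟨r, rfl⟩
        · exact bot_le
        · exact absurd (hne.some_mem hx) (not_top_le_toExt _)
        · exact toExt_le_toExt.2 (hb.2 fun c hc => toExt_le_toExt.1 (hc hx))
      · rcases Ext.cases x with rfl | rfl | ⟨r, rfl⟩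
        · obtain ⟨c, hc⟩ := hbdd
          have : c ≤ c - 1 := hc (show toExt (c - 1) ∈ upperBounds S from
            fun y hy => (hx hy).trans bot_le)
          linarith
        · exact le_top
        · exact toExt_le_toExt.2 (hb.1 hx)
    · refine ⟨⊥, fun x hx => ?_, fun _ _ => bot_le⟩
      rcases Ext.cases x with rfl | rfl | ⟨r, rfl⟩
      · exact le_rfl
      · exact absurd (hne.some_mem hx) (not_top_le_toExt _)
      · exact absurd ⟨r, fun c hc => toExt_le_toExt.1 (hc hx)⟩ hbdd
  · refine ⟨⊤, fun _ _ => le_top, fun x hx => ?_⟩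
    rcases Ext.cases x with rfl | rfl | ⟨r, rfl⟩
    · exact absurd ⟨0, fun y hy => (hx hy).trans bot_le⟩ hne
    · exact le_rfl
    · exact absurd ⟨r, hx⟩ hne

theorem exists_isGLB_of_definable (hR : DefinablyComplete L R) (S : Set (Ext R))
    (hS : (Set.univ : Set R).Definable₁ L {r | toExt r ∈ lowerBounds S}) : ∃ b, IsGLB S b := by
  by_cases hne : {r : R | toExt r ∈ lowerBounds S}.Nonempty
  · by_cases hbdd : BddAbove {r : R | toExt r ∈ lowerBounds S}
    · obtain ⟨b, hb⟩ := hR _ hS hne hbdd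
      refine ⟨toExt b, fun x hx => ?_, fun x hx => ?_⟩
      · rcases Ext.cases x with rfl | rfl | ⟨r, rfl⟩
        · exact absurd (hne.some_mem hx) (not_toExt_le_bot _)
        · exact le_top
        · exact toExt_le_toExt.2 (hb.2 fun c hc => toExt_le_toExt.1 (hc hx))
      · rcases Ext.cases x with rfl | rfl | ⟨r, rfl⟩
        · exact bot_le
        · obtain ⟨c, hc⟩ := hbdd
          have : c + 1 ≤ c := hc (show toExt (c + 1) ∈ lowerBounds S from
            fun y hy => le_top.trans (hx hy))
          linarith
        · exact toExt_le_toExt.2 (hb.1 hx)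
    · refine ⟨⊤, fun x hx => ?_, fun _ _ => le_top⟩
      rcases Ext.cases x with rfl | rfl | ⟨r, rfl⟩
      · exact absurd (hne.some_mem hx) (not_toExt_le_bot _)
      · exact le_rfl
      · exact absurd ⟨r, fun c hc => toExt_le_toExt.1 (hc hx)⟩ hbdd
  · refine ⟨⊥, fun _ _ => bot_le, fun x hx => ?_⟩
    rcases Ext.cases x with rfl | rfl | ⟨r, rfl⟩
    · exact le_rfl
    · exact absurd ⟨0, fun y hy => le_top.trans (hx hy)⟩ hne
    · exact absurd ⟨r, hx⟩ hne

/-- The upper bounds of `c - x` in terms of those of `x`. -/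
theorem subExt_le_toExt_iff {c r : R} {x : Ext R} :
    subExt c x ≤ toExt r ↔ ∀ s : R, x ≤ toExt s → c - s ≤ r := by
  rcases Ext.cases x with rfl | rfl | ⟨a, rfl⟩
  · refine iff_of_false (not_top_le_toExt r) fun h => ?_
    have := h (c - r - 1) bot_le
    linarith
  · exact iff_of_true bot_le fun s hs => absurd hs (not_top_le_toExt s)
  · change toExt (c - a) ≤ _ ↔ _
    simp only [toExt_le_toExt]
    exact ⟨fun h s hs => by linarith, fun h => h a le_rfl⟩

/-- The lower bounds of `½ x + ½ y + k` in terms of the upper bounds of `x` and `y`. -/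
theorem toExt_le_scaleExt_add_iff {r k : R} {x y : Ext R} (hx : x ≠ ⊥) (hy : y ≠ ⊥) :
    toExt r ≤ scaleExt (1 / 2) x + scaleExt (1 / 2) y + toExt k ↔
      ∀ a b : R, x ≤ toExt a → y ≤ toExt b → r ≤ 1 / 2 * a + 1 / 2 * b + k := by
  rcases Ext.cases x with rfl | rfl | ⟨a, rfl⟩
  · exact absurd rfl hx
  · refine iff_of_true ?_ fun a b ha => absurd ha (not_top_le_toExt a)
    -- Here `x = ⊤` has no upper bound in `R`, so the right side is vacuous; but `⊤ + ⊥ = ⊥`, which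
    -- is why `y = ⊥` must be excluded.
    rcases Ext.cases y with rfl | rfl | ⟨b, rfl⟩
    · exact absurd rfl hy
    all_goals exact le_top (a := toExt r)
  · rcases Ext.cases y with rfl | rfl | ⟨b, rfl⟩
    · exact absurd rfl hy
    · exact iff_of_true (le_top (a := toExt r)) fun a b _ hb => absurd hb (not_top_le_toExt b)
    · change toExt r ≤ toExt (1 / 2 * a + 1 / 2 * b + k) ↔ _
      simp only [toExt_le_toExt]
      exact ⟨fun h s t hs ht => by linarith, fun h => h a b le_rfl le_rfl⟩

end Ext

/-! ### The duality product on `Rⁿ × Rⁿ` -/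

section Duality

variable {R : Type w} {n : ℕ}

/-- The transpose `(x*, x)` of `(x, x*)`. -/
def swap (v : Fin n ⊕ Fin n → R) : Fin n ⊕ Fin n → R :=
  Sum.elim (v ∘ Sum.inr) (v ∘ Sum.inl)

@[simp] theorem swap_swap (v : Fin n ⊕ Fin n → R) : swap (swap v) = v := by
  ext (i | i) <;> rfl

variable [Field R]

/-- The duality product `⟨x, x*⟩` as a function of `(x, x*)`. -/
def dual (v : Fin n ⊕ Fin n → R) : R :=
  (v ∘ Sum.inl) ⬝ᵥ (v ∘ Sum.inr)

theorem swap_add (v w : Fin n ⊕ Fin n → R) : swap (v + w) = swap v + swap w := by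
  ext (i | i) <;> rfl

theorem swap_sub (v w : Fin n ⊕ Fin n → R) : swap (v - w) = swap v - swap w := by
  ext (i | i) <;> rfl

theorem swap_smul (c : R) (v : Fin n ⊕ Fin n → R) : swap (c • v) = c • swap v := by
  ext (i | i) <;> rfl

theorem dotProduct_eq_add (v w : Fin n ⊕ Fin n → R) :
    v ⬝ᵥ w = (v ∘ Sum.inl) ⬝ᵥ (w ∘ Sum.inl) + (v ∘ Sum.inr) ⬝ᵥ (w ∘ Sum.inr) := by
  simp [dotProduct, Fintype.sum_sum_type]

theorem swap_dotProduct_swap (v w : Fin n ⊕ Fin n → R) : swap v ⬝ᵥ swap w = v ⬝ᵥ w := by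
  rw [dotProduct_eq_add, dotProduct_eq_add v w, add_comm]
  rfl

theorem swap_dotProduct (v w : Fin n ⊕ Fin n → R) : swap v ⬝ᵥ w = v ⬝ᵥ swap w := by
  rw [← swap_dotProduct_swap, swap_swap]

theorem dotProduct_swap_self (v : Fin n ⊕ Fin n → R) : v ⬝ᵥ swap v = 2 * dual v := by
  rw [dotProduct_eq_add, two_mul]
  exact congrArg₂ _ rfl (dotProduct_comm _ _)

theorem dual_add (v w : Fin n ⊕ Fin n → R) : dual (v + w) = dual v + dual w + v ⬝ᵥ swap w := by
  have h : v ⬝ᵥ swap w = (v ∘ Sum.inl) ⬝ᵥ (w ∘ Sum.inr) + (v ∘ Sum.inr) ⬝ᵥ (w ∘ Sum.inl) :=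
    dotProduct_eq_add _ _
  have h1 : (v + w) ∘ Sum.inl = v ∘ Sum.inl + w ∘ Sum.inl := rfl
  have h2 : (v + w) ∘ Sum.inr = v ∘ Sum.inr + w ∘ Sum.inr := rfl
  rw [h, dual, dual, dual, h1, h2, add_dotProduct, dotProduct_add, dotProduct_add,
    dotProduct_comm (v ∘ Sum.inr)]
  ring

theorem dual_smul (c : R) (v : Fin n ⊕ Fin n → R) : dual (c • v) = c ^ 2 * dual v := by
  have h1 : (c • v) ∘ Sum.inl = c • (v ∘ Sum.inl) := rfl
  have h2 : (c • v) ∘ Sum.inr = c • (v ∘ Sum.inr) := rfl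
  rw [dual, dual, h1, h2, smul_dotProduct, dotProduct_smul, smul_eq_mul, smul_eq_mul]
  ring

theorem dual_sub (v w : Fin n ⊕ Fin n → R) : dual (v - w) = dual v + dual w - v ⬝ᵥ swap w := by
  have h := dual_add (v - w) w
  rw [sub_add_cancel, sub_dotProduct, dotProduct_swap_self] at h
  rw [h]
  ring

end Duality

/-! ### Dot-product estimates over an ordered field -/

section Euclidean

variable {R : Type w} [Field R] [LinearOrder R] [IsStrictOrderedRing R] {ι : Type*} [Fintype ι]

theorem dotProduct_self_nonneg (v : ι → R) : 0 ≤ v ⬝ᵥ v :=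
  Finset.sum_nonneg fun i _ => mul_self_nonneg (v i)

theorem mul_self_le_dotProduct_self (v : ι → R) (i : ι) : v i * v i ≤ v ⬝ᵥ v :=
  Finset.single_le_sum (f := fun i => v i * v i) (fun i _ => mul_self_nonneg (v i))
    (Finset.mem_univ i)

theorem eq_zero_of_dotProduct_self_nonpos {v : ι → R} (h : v ⬝ᵥ v ≤ 0) : v = 0 :=
  funext fun i => mul_self_eq_zero.1
    (le_antisymm ((mul_self_le_dotProduct_self v i).trans h) (mul_self_nonneg _))

theorem dotProduct_le_of_abs_le (u : ι → R) {v : ι → R} {δ : R} (h : ∀ i, |v i| ≤ δ) :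
    u ⬝ᵥ v ≤ δ * ∑ i, |u i| := by
  rw [Finset.mul_sum]
  refine Finset.sum_le_sum fun i _ => ?_
  calc u i * v i ≤ |u i| * |v i| := by rw [← abs_mul]; exact le_abs_self _
    _ ≤ |u i| * δ := mul_le_mul_of_nonneg_left (h i) (abs_nonneg _)
    _ = δ * |u i| := mul_comm _ _

/-- Stands in for letting `t` tend to `0` from above. -/
theorem le_of_forall_le_add_mul {x y C : R} (h : ∀ t, 0 < t → t ≤ 1 → x ≤ y + t * C) :
    x ≤ y := by
  rcases le_or_gt C 0 with hC | hC
  · linarith [h 1 one_pos le_rfl]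
  by_contra! hxy
  have hd : 0 < (x - y) / (2 * C) := div_pos (sub_pos.2 hxy) (by linarith)
  have h1 := h (min 1 ((x - y) / (2 * C))) (lt_min one_pos hd) (min_le_left _ _)
  have h2 : min 1 ((x - y) / (2 * C)) * C ≤ (x - y) / (2 * C) * C :=
    mul_le_mul_of_nonneg_right (min_le_right _ _) hC.le
  have h3 : (x - y) / (2 * C) * C = (x - y) / 2 := by field_simp
  linarith

end Euclidean

/-! ### Bounds of the Fitzpatrick function, its conjugate and the proximal average -/

section Bounds

variable {R : Type w} [Field R] [LinearOrder R] {n : ℕ}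

/-- `r` is an upper bound of the values at `v` of the affine functions which define the Fitzpatrick
function of the map with graph `G`. -/
def FitzpatrickLE (G : Set (Fin n ⊕ Fin n → R)) (v : Fin n ⊕ Fin n → R) (r : R) : Prop :=
  ∀ a ∈ G, v ⬝ᵥ swap a - dual a ≤ r

/-- `r` is an upper bound of the terms of the conjugate at `y` of the Fitzpatrick function. -/
def ConjugateLE (G : Set (Fin n ⊕ Fin n → R)) (y : Fin n ⊕ Fin n → R) (r : R) : Prop :=
  ∀ v s, FitzpatrickLE G v s → v ⬝ᵥ y - s ≤ r

/-- `r` is a lower bound of the terms of the proximal average at `v` of the Fitzpatrick function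
and the transpose of its conjugate. -/
def LEPsi (G : Set (Fin n ⊕ Fin n → R)) (v : Fin n ⊕ Fin n → R) (r : R) : Prop :=
  ∀ y z a b, y + z = (2 : R) • v → FitzpatrickLE G y a → ConjugateLE G (swap z) b →
    r ≤ 1 / 2 * a + 1 / 2 * b + 1 / 4 * kappa y z

variable {G : Set (Fin n ⊕ Fin n → R)}

theorem LEPsi.mono {v : Fin n ⊕ Fin n → R} {r s : R} (h : LEPsi G v s) (hrs : r ≤ s) :
    LEPsi G v r :=
  fun y z a b h1 h2 h3 => hrs.trans (h y z a b h1 h2 h3)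

variable [IsStrictOrderedRing R]

/-- Expand `‖v - swap v‖² ≥ 0`; equality holds exactly when `v = swap v`. -/
theorem two_mul_dual_le (v : Fin n ⊕ Fin n → R) : 2 * dual v ≤ v ⬝ᵥ v := by
  have h := dotProduct_self_nonneg (v - swap v)
  rw [dotProduct_sub, sub_dotProduct, sub_dotProduct, swap_dotProduct_swap, swap_dotProduct,
    dotProduct_swap_self] at h
  linarith

theorem FitzpatrickLE.convex {v w : Fin n ⊕ Fin n → R} {r s t : R} (hv : FitzpatrickLE G v r)
    (hw : FitzpatrickLE G w s) (h0 : 0 ≤ t) (h1 : t ≤ 1) :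
    FitzpatrickLE G (v + t • (w - v)) (r + t * (s - r)) := by
  intro a ha
  have h2 := mul_le_mul_of_nonneg_left (hw a ha) h0
  have h3 := mul_le_mul_of_nonneg_left (hv a ha) (sub_nonneg.2 h1)
  rw [add_dotProduct, smul_dotProduct, sub_dotProduct, smul_eq_mul]
  linarith

theorem ConjugateLE.midpoint {v w : Fin n ⊕ Fin n → R} {r s : R} (hv : ConjugateLE G v r)
    (hw : ConjugateLE G w s) :
    ConjugateLE G ((1 / 2 : R) • (v + w)) (1 / 2 * (r + s)) := by
  intro x t hx
  rw [dotProduct_smul, dotProduct_add, smul_eq_mul]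
  linarith [hv x t hx, hw x t hx]

theorem FitzpatrickLE.midpoint {v w : Fin n ⊕ Fin n → R} {r s : R} (hv : FitzpatrickLE G v r)
    (hw : FitzpatrickLE G w s) :
    FitzpatrickLE G ((1 / 2 : R) • (v + w)) (1 / 2 * (r + s)) := by
  intro x hx
  rw [smul_dotProduct, add_dotProduct, smul_eq_mul]
  linarith [hv x hx, hw x hx]

theorem fitzpatrickLE_dual (hG : ∀ a ∈ G, ∀ b ∈ G, 0 ≤ dual (a - b)) {a : Fin n ⊕ Fin n → R}
    (ha : a ∈ G) : FitzpatrickLE G a (dual a) := by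
  intro b hb
  have := hG a ha b hb
  rw [dual_sub] at this
  linarith

theorem conjugateLE_dual {a : Fin n ⊕ Fin n → R} (ha : a ∈ G) :
    ConjugateLE G (swap a) (dual a) := by
  intro v s hs
  linarith [hs a ha]

/-- With `y + z = 2 v`, `4 * dual v = dual (y - z) + 2 * (y ⬝ᵥ swap z)`. The first term is at most
`½ ‖y - z‖²`, and Fenchel–Young bounds the second by `2 * (a + b)`. -/
theorem lePsi_dual (v : Fin n ⊕ Fin n → R) : LEPsi G v (dual v) := by
  intro y z a b hyz ha hb
  have h1 := hb y a ha
  have h2 : 4 * dual v = dual y + dual z + y ⬝ᵥ swap z := by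
    rw [← dual_add, hyz, dual_smul]
    ring
  have h3 := two_mul_dual_le (y - z)
  rw [dual_sub] at h3
  rw [kappa]
  linarith

theorem lePsi_le_dual_of_mem (hG : ∀ a ∈ G, ∀ b ∈ G, 0 ≤ dual (a - b)) {v : Fin n ⊕ Fin n → R}
    (hv : v ∈ G) {r : R} (h : LEPsi G v r) : r ≤ dual v := by
  -- The decomposition `y = z = v` makes the quadratic term vanish.
  have := h v v _ _ (two_smul R v).symm (fitzpatrickLE_dual hG hv) (conjugateLE_dual hv)
  rw [kappa, sub_self, dotProduct_zero] at this
  linarith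

/-- Convexity of `Ψ_T` together with `Ψ_T ≥ dual` gives `2 * dual (½ (v + w)) ≤ dual v + dual w`,
which rearranges to the claim. -/
theorem dual_sub_nonneg_of_lePsi {v w : Fin n ⊕ Fin n → R} (hv : ∀ r, LEPsi G v r → r ≤ dual v)
    (hw : ∀ r, LEPsi G w r → r ≤ dual w) : 0 ≤ dual (v - w) := by
  have key : LEPsi G v (2 * dual ((1 / 2 : R) • (v + w)) - dual w) := by
    intro y z a b hyz ha hb
    -- Midpoint convexity is proved one infimum at a time: fix a decomposition of `v`, then let that
    -- of `w` vary; their average decomposes the midpoint.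
    have : LEPsi G w (2 * dual ((1 / 2 : R) • (v + w)) -
        (1 / 2 * a + 1 / 2 * b + 1 / 4 * kappa y z)) := by
      intro y' z' a' b' hyz' ha' hb'
      have h := lePsi_dual (G := G) ((1 / 2 : R) • (v + w)) ((1 / 2 : R) • (y + y'))
        ((1 / 2 : R) • (z + z')) (1 / 2 * (a + a')) (1 / 2 * (b + b')) ?_ (ha.midpoint ha') ?_
      · have h2 : kappa ((1 / 2 : R) • (y + y')) ((1 / 2 : R) • (z + z')) ≤
            1 / 2 * kappa y z + 1 / 2 * kappa y' z' := by
          have e : (1 / 2 : R) • (y + y') - (1 / 2 : R) • (z + z') =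
              (1 / 2 : R) • ((y - z) + (y' - z')) := by
            module
          have h3 := dotProduct_self_nonneg ((y - z) - (y' - z'))
          rw [kappa, kappa, kappa, e]
          generalize y - z = p at *
          generalize y' - z' = q at *
          rw [dotProduct_sub, sub_dotProduct, sub_dotProduct] at h3
          rw [smul_dotProduct, dotProduct_smul, dotProduct_add, add_dotProduct, add_dotProduct,
            smul_eq_mul, smul_eq_mul]
          linarith
        linarith
      · have : (1 / 2 : R) • (y + y') + (1 / 2 : R) • (z + z') =
            (1 / 2 : R) • ((y + z) + (y' + z')) := by
          module
        rw [this, hyz, hyz']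
        module
      · rw [swap_smul, swap_add]
        exact hb.midpoint hb'
    linarith [hw _ this]
  have h := hv _ key
  rw [dual_smul, dual_add] at h
  rw [dual_sub]
  linarith

end Bounds

/-! ### Definability of the bounds -/

section Definability

variable {L : FirstOrder.Language.{u, v}} {R : Type w} [L.Structure R] {n : ℕ} {α : Type*}

theorem definableMap_swap {F : (α → R) → Fin n ⊕ Fin n → R}
    (hF : (Set.univ : Set R).DefinableMap L F) :
    (Set.univ : Set R).DefinableMap L fun x => swap (F x) := by
  rintro (i | i)
  · exact hF (Sum.inr i)
  · exact hF (Sum.inl i)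

theorem definableMap_proj {β : Type*} (f : β → α) :
    (Set.univ : Set R).DefinableMap L fun (x : α → R) i => x (f i) :=
  fun _ => .proj L

theorem definable_comp₂ {β : Type*} [Finite β] {P : (β → R) → R → Prop}
    (hP : (Set.univ : Set R).Definable L
      {z : β ⊕ Unit → R | P (fun i => z (Sum.inl i)) (z (Sum.inr ()))})
    {F : (α → R) → β → R} {f : (α → R) → R} (hF : (Set.univ : Set R).DefinableMap L F)
    (hf : (Set.univ : Set R).DefinableFun L f) :
    (Set.univ : Set R).Definable L {x | P (F x) (f x)} := by
  have hm : (Set.univ : Set R).DefinableMap L fun x => Sum.elim (F x) fun _ : Unit => f x := by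
    rintro (i | i)
    · exact hF i
    · exact hf
  exact hP.preimage_map hm

variable [Field R] [LinearOrder R] {G : Set (Fin n ⊕ Fin n → R)}
variable (hL : IsOrderedFieldExpansion L R) (hG : (Set.univ : Set R).Definable L G)
include hL hG

theorem definable_fitzpatrickLE {F : (α → R) → Fin n ⊕ Fin n → R} {f : (α → R) → R}
    (hF : (Set.univ : Set R).DefinableMap L F) (hf : (Set.univ : Set R).DefinableFun L f) :
    (Set.univ : Set R).Definable L {x | FitzpatrickLE G (F x) (f x)} := by
  refine definable_comp₂ (P := FitzpatrickLE G) ?_ hF hf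
  refine definable_forall (definable_imp (hG.preimage_comp Sum.inr) (hL.definable_le
    (hL.definableFun_sub (hL.definableFun_dotProduct (definableMap_proj _)
      (definableMap_swap (definableMap_proj _)))
    (hL.definableFun_dotProduct ?_ ?_)) (.proj L)))
  · exact definableMap_proj fun i => Sum.inr (Sum.inl i)
  · exact definableMap_proj fun i => Sum.inr (Sum.inr i)

theorem definable_conjugateLE {F : (α → R) → Fin n ⊕ Fin n → R} {f : (α → R) → R}
    (hF : (Set.univ : Set R).DefinableMap L F) (hf : (Set.univ : Set R).DefinableFun L f) :
    (Set.univ : Set R).Definable L {x | ConjugateLE G (F x) (f x)} := by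
  refine definable_comp₂ (P := ConjugateLE G) ?_ hF hf
  exact definable_forall (definable_forall_elem (definable_imp
    (definable_fitzpatrickLE hL hG (definableMap_proj _) (.proj L))
    (hL.definable_le (hL.definableFun_sub (hL.definableFun_dotProduct (definableMap_proj _)
      (definableMap_proj _)) (.proj L)) (.proj L))))

theorem definable_lePsi {F : (α → R) → Fin n ⊕ Fin n → R} {f : (α → R) → R}
    (hF : (Set.univ : Set R).DefinableMap L F) (hf : (Set.univ : Set R).DefinableFun L f) :
    (Set.univ : Set R).Definable L {x | LEPsi G (F x) (f x)} := by
  refine definable_comp₂ (P := LEPsi G) ?_ hF hf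
  refine definable_forall (definable_forall (definable_forall_elem (definable_forall_elem
    (definable_imp ?_ (definable_imp (definable_fitzpatrickLE hL hG (definableMap_proj _) (.proj L))
    (definable_imp (definable_conjugateLE hL hG (definableMap_swap (definableMap_proj _)) (.proj L))
      (hL.definable_le (.proj L) (hL.definableFun_add (hL.definableFun_add
        (hL.definableFun_mul (definableFun_const _) (.proj L))
        (hL.definableFun_mul (definableFun_const _) (.proj L)))
        (hL.definableFun_mul (definableFun_const _) ?_)))))))))
  · simp only [funext_iff, Set.ofPred_forall]
    exact Set.definable_iInter_of_finite fun i => Set.DefinableFun.ofPred_eq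
      (hL.definableFun_add (.proj L) (.proj L))
      (hL.definableFun_mul (definableFun_const _) (.proj L))
  · have h : (Set.univ : Set R).DefinableMap L
        fun (x : (((((Fin n ⊕ Fin n) ⊕ Unit) ⊕ (Fin n ⊕ Fin n)) ⊕ (Fin n ⊕ Fin n)) ⊕ Unit) ⊕ Unit
          → R) => (fun i => x (Sum.inl (Sum.inl (Sum.inl (Sum.inr i))))) -
            fun i => x (Sum.inl (Sum.inl (Sum.inr i))) :=
      fun i => hL.definableFun_sub (.proj L) (.proj L)
    exact hL.definableFun_mul (definableFun_const _) (hL.definableFun_dotProduct h h)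

end Definability

/-! ### The proximal point of the Fitzpatrick function -/

section Proximal

variable {L : FirstOrder.Language.{u, v}} {R : Type w} [Field R] [LinearOrder R]
  [L.Structure R] {n : ℕ} {G : Set (Fin n ⊕ Fin n → R)}

/-- The value `s + ½ ‖y - c‖²`. -/
def proxValue (c y : Fin n ⊕ Fin n → R) (s : R) : R :=
  s + 1 / 2 * ((y - c) ⬝ᵥ (y - c))

theorem definableFun_proxValue (hL : IsOrderedFieldExpansion L R) {α : Type*}
    (c : Fin n ⊕ Fin n → R)
    {F : (α → R) → Fin n ⊕ Fin n → R} {f : (α → R) → R}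
    (hF : (Set.univ : Set R).DefinableMap L F) (hf : (Set.univ : Set R).DefinableFun L f) :
    (Set.univ : Set R).DefinableFun L fun x => proxValue c (F x) (f x) := by
  have h : (Set.univ : Set R).DefinableMap L fun x => F x - c :=
    fun i => hL.definableFun_sub (hF i) (definableFun_const _)
  exact hL.definableFun_add hf (hL.definableFun_mul (definableFun_const _)
    (hL.definableFun_dotProduct h h))

variable [IsStrictOrderedRing R]

/-- The infimum of `s + ½ ‖y - c‖²` over the epigraph of the Fitzpatrick function. -/
theorem exists_isLUB_proxValue (hL : IsOrderedFieldExpansion L R) (hR : DefinablyComplete L R)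
    (hG : (Set.univ : Set R).Definable L G) (hne : G.Nonempty)
    (hdom : ∃ y s, FitzpatrickLE G y s) (c : Fin n ⊕ Fin n → R) :
    ∃ m, IsLUB {r | ∀ y s, FitzpatrickLE G y s → r ≤ proxValue c y s} m := by
  refine hR _ ?_ ?_ ?_
  · exact definable_forall (P := fun (x : Fin 1 → R) y => ∀ s, FitzpatrickLE G y s →
      x 0 ≤ proxValue c y s) (definable_forall_elem (definable_imp
      (definable_fitzpatrickLE hL hG (definableMap_proj _) (.proj L))
      (hL.definable_le (.proj L)
        (definableFun_proxValue hL c (definableMap_proj _) (.proj L)))))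
  · obtain ⟨a, ha⟩ := hne
    -- The affine minorant of `Φ_T` given by `a`, plus `½ ‖y - c‖²`, has this minimum, found by
    -- completing the square.
    refine ⟨c ⬝ᵥ swap a - 1 / 2 * (swap a ⬝ᵥ swap a) - dual a, fun y s hs => ?_⟩
    have h := hs a ha
    have h1 := dotProduct_self_nonneg (y - c + swap a)
    have h2 : y ⬝ᵥ swap a = (y - c) ⬝ᵥ swap a + c ⬝ᵥ swap a := by
      rw [sub_dotProduct, sub_add_cancel]
    rw [proxValue]
    generalize y - c = d at *
    rw [dotProduct_add, add_dotProduct, add_dotProduct, dotProduct_comm (swap a) d] at h1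
    linarith
  · obtain ⟨y, s, hs⟩ := hdom
    exact ⟨proxValue c y s, fun r hr => hr y s hs⟩

/-- Parallelogram identity: the value at the midpoint of two near-minimizers drops by `⅛ ‖y - z‖²`
below the average, yet stays at least `m`. -/
theorem dotProduct_sub_self_le {c : Fin n ⊕ Fin n → R} {m ε : R}
    (hm : ∀ y s, FitzpatrickLE G y s → m ≤ proxValue c y s) {y z : Fin n ⊕ Fin n → R} {s t : R}
    (hy : FitzpatrickLE G y s) (hz : FitzpatrickLE G z t) (hys : proxValue c y s ≤ m + ε)
    (hzt : proxValue c z t ≤ m + ε) : (y - z) ⬝ᵥ (y - z) ≤ 8 * ε := by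
  have h := hm _ _ (hy.midpoint hz)
  have e1 : (1 / 2 : R) • (y + z) - c = (1 / 2 : R) • ((y - c) + (z - c)) := by module
  have e2 : y - z = (y - c) - (z - c) := by module
  rw [proxValue, e1] at h
  rw [proxValue] at hys hzt
  rw [e2]
  generalize y - c = p at *
  generalize z - c = q at *
  rw [smul_dotProduct, dotProduct_smul, dotProduct_add, add_dotProduct, add_dotProduct,
    smul_eq_mul, smul_eq_mul] at h
  rw [dotProduct_sub, sub_dotProduct, sub_dotProduct]
  linarith

/-- Near-minimizers with tolerance `⅛ δ²` agree up to `δ` in each coordinate, so they converge as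
`δ` tends to `0`. The infimum is attained at the limit because `Φ_T` is a supremum of affine
functions. -/
theorem exists_minimizer (hL : IsOrderedFieldExpansion L R) (hR : DefinablyComplete L R)
    (hG : (Set.univ : Set R).Definable L G) {c : Fin n ⊕ Fin n → R} {m : R}
    (hm : IsLUB {r | ∀ y s, FitzpatrickLE G y s → r ≤ proxValue c y s} m) :
    ∃ p, FitzpatrickLE G p (m - 1 / 2 * ((p - c) ⬝ᵥ (p - c))) := by
  have hm' : ∀ y s, FitzpatrickLE G y s → m ≤ proxValue c y s :=
    fun y s hs => hm.2 fun r hr => hr y s hs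
  have happrox : ∀ ε : R, 0 < ε → ∃ y s, FitzpatrickLE G y s ∧ proxValue c y s ≤ m + ε := by
    intro ε hε
    by_contra! h
    have := hm.1 (show m + ε ∈ {r | ∀ y s, FitzpatrickLE G y s → r ≤ proxValue c y s} from
      fun y s hs => (h y s hs).le)
    linarith
  have hclose : ∀ δ : R, 0 < δ → ∀ y z s t, FitzpatrickLE G y s → FitzpatrickLE G z t →
      proxValue c y s ≤ m + 1 / 8 * (δ * δ) → proxValue c z t ≤ m + 1 / 8 * (δ * δ) →
      ∀ i, |y i - z i| ≤ δ := by
    intro δ hδ y z s t hy hz hys hzt i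
    have h := (mul_self_le_dotProduct_self (y - z) i).trans
      (dotProduct_sub_self_le hm' hy hz hys hzt)
    refine abs_le_of_sq_le_sq ?_ hδ.le
    simp only [Pi.sub_apply] at h
    nlinarith
  -- The `i`-th coordinate of the limit is the lower limit of the `i`-th coordinates of
  -- near-minimizers.
  have hlim : ∀ i, ∃ b, IsLUB {x | ∃ δ : R, 0 < δ ∧ ∀ y s, FitzpatrickLE G y s →
      proxValue c y s ≤ m + 1 / 8 * (δ * δ) → x ≤ y i} b := by
    intro i
    refine hR _ ?_ ?_ ?_
    · exact definable_exists_elem (P := fun (x : Fin 1 → R) δ => 0 < δ ∧ ∀ y s,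
        FitzpatrickLE G y s → proxValue c y s ≤ m + 1 / 8 * (δ * δ) → x 0 ≤ y i)
        (definable_and (hL.definable_lt (definableFun_const _) (.proj L))
          (definable_forall (definable_forall_elem (definable_imp
            (definable_fitzpatrickLE hL hG (definableMap_proj _) (.proj L))
            (definable_imp (hL.definable_le
              (definableFun_proxValue hL c (definableMap_proj _) (.proj L))
              (hL.definableFun_add (definableFun_const _) (hL.definableFun_mul
                (definableFun_const _) (hL.definableFun_mul (.proj L) (.proj L)))))
              (hL.definable_le (.proj L) (.proj L)))))))
    · obtain ⟨y, s, hs, hys⟩ := happrox (1 / 8 * (1 * 1)) (by norm_num)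
      refine ⟨y i - 1, 1, one_pos, fun z t ht hzt => ?_⟩
      linarith [(abs_le.1 (hclose 1 one_pos y z s t hs ht hys hzt i)).2]
    · obtain ⟨y, s, hs, hys⟩ := happrox (1 / 8 * (1 * 1)) (by norm_num)
      refine ⟨y i + 1, ?_⟩
      rintro x ⟨δ, hδ, hx⟩
      have hμ : 0 < min δ 1 := lt_min hδ one_pos
      -- The smaller tolerance makes `z` a near-minimizer for both `δ` and `1`.
      obtain ⟨z, t, ht, hzt⟩ := happrox (1 / 8 * (min δ 1 * min δ 1)) (by positivity)
      have h1 := mul_self_le_mul_self hμ.le (min_le_left δ 1)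
      have h2 := mul_self_le_mul_self hμ.le (min_le_right δ 1)
      have h3 := hx z t ht (by linarith)
      linarith [(abs_le.1 (hclose 1 one_pos y z s t hs ht hys (by linarith) i)).1]
  choose p hp using hlim
  have hpy : ∀ δ : R, 0 < δ → ∀ y s, FitzpatrickLE G y s →
      proxValue c y s ≤ m + 1 / 8 * (δ * δ) → ∀ i, |(p - y) i| ≤ δ := by
    intro δ hδ y s hs hys i
    rw [Pi.sub_apply, abs_le]
    constructor
    · have : y i - δ ≤ p i := (hp i).1 ⟨δ, hδ, fun z t ht hzt => by
        linarith [(abs_le.1 (hclose δ hδ y z s t hs ht hys hzt i)).2]⟩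
      linarith
    · have : p i ≤ y i + δ := by
        refine (hp i).2 ?_
        rintro x ⟨η, hη, hx⟩
        have hμ : 0 < min η δ := lt_min hη hδ
        obtain ⟨z, t, ht, hzt⟩ := happrox (1 / 8 * (min η δ * min η δ)) (by positivity)
        have h1 := mul_self_le_mul_self hμ.le (min_le_left η δ)
        have h2 := mul_self_le_mul_self hμ.le (min_le_right η δ)
        have h3 := hx z t ht (by linarith)
        linarith [(abs_le.1 (hclose δ hδ y z s t hs ht hys (by linarith) i)).1]
      linarith
  refine ⟨p, fun a ha => ?_⟩
  -- The `1 / 8` absorbs the tolerance, by `δ * δ ≤ δ`; the sum absorbs replacing `p` by `y` in the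
  -- affine and quadratic terms.
  refine le_of_forall_le_add_mul (C := 1 / 8 + ∑ i, |(p - c + swap a) i|) fun δ hδ hδ1 => ?_
  obtain ⟨y, s, hs, hys⟩ := happrox (1 / 8 * (δ * δ)) (by positivity)
  have h1 := dotProduct_le_of_abs_le (p - c + swap a) (hpy δ hδ y s hs hys)
  have h2 := hs a ha
  have h3 := dotProduct_self_nonneg (p - y)
  have h4 : δ * δ ≤ δ := mul_le_of_le_one_right hδ.le hδ1
  have e1 : y - c = (p - c) - (p - y) := by module
  have e2 : y ⬝ᵥ swap a = p ⬝ᵥ swap a - swap a ⬝ᵥ (p - y) := by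
    rw [dotProduct_sub, dotProduct_comm p, dotProduct_comm y]
    ring
  rw [proxValue, e1] at hys
  rw [e2] at h2
  generalize p - c = d at *
  generalize p - y = f at *
  rw [add_dotProduct] at h1
  rw [dotProduct_sub, sub_dotProduct, sub_dotProduct, dotProduct_comm f d] at hys
  linarith

/-- The proximal point `y` of the Fitzpatrick function at `c`: the difference `c - y` is a
subgradient at `y`. -/
theorem exists_proximal_point (hL : IsOrderedFieldExpansion L R) (hR : DefinablyComplete L R)
    (hG : (Set.univ : Set R).Definable L G) (hne : G.Nonempty)
    (hdom : ∃ y s, FitzpatrickLE G y s) (c : Fin n ⊕ Fin n → R) :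
    ∃ y r, FitzpatrickLE G y r ∧
      ∀ v s, FitzpatrickLE G v s → r + (c - y) ⬝ᵥ (v - y) ≤ s := by
  obtain ⟨m, hm⟩ := exists_isLUB_proxValue hL hR hG hne hdom c
  obtain ⟨p, hp⟩ := exists_minimizer hL hR hG hm
  refine ⟨p, _, hp, fun v s hs => ?_⟩
  -- First-order optimality: compare `p` with `p + t • (v - p)`, divide by `t`, and let `t` tend to
  -- `0`.
  refine le_of_forall_le_add_mul (C := 1 / 2 * ((v - p) ⬝ᵥ (v - p))) fun t ht ht1 => ?_
  have h : m ≤ proxValue c _ _ := hm.2 fun r hr => hr _ _ (hp.convex hs ht.le ht1)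
  have e1 : p + t • (v - p) - c = t • (v - p) - (c - p) := by module
  have e2 : (p - c) ⬝ᵥ (p - c) = (c - p) ⬝ᵥ (c - p) := by
    rw [← neg_sub, neg_dotProduct_neg]
  rw [proxValue, e1, e2] at h
  rw [e2]
  generalize v - p = d at *
  generalize c - p = f at *
  rw [dotProduct_sub, sub_dotProduct, sub_dotProduct, smul_dotProduct, smul_dotProduct,
    dotProduct_smul, dotProduct_smul, dotProduct_comm d f] at h
  simp only [smul_eq_mul] at h
  refine le_of_mul_le_mul_left ?_ ht
  linarith

/-- Pairs which are monotonically related to the map represented by the proximal average belong to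
its graph. -/
theorem mem_of_monotonicallyRelated (hL : IsOrderedFieldExpansion L R)
    (hR : DefinablyComplete L R) (hG : (Set.univ : Set R).Definable L G) (hne : G.Nonempty)
    (hmon : ∀ a ∈ G, ∀ b ∈ G, 0 ≤ dual (a - b)) {w : Fin n ⊕ Fin n → R}
    (hw : ∀ v, (∀ r, LEPsi G v r → r ≤ dual v) → 0 ≤ dual (w - v)) :
    ∀ r, LEPsi G w r → r ≤ dual w := by
  obtain ⟨y, r, hy, hyr⟩ := exists_proximal_point hL hR hG hne
    ⟨_, _, fitzpatrickLE_dual hmon hne.some_mem⟩ (w + swap w)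
  obtain ⟨u, rfl⟩ : ∃ u, y = w + u := ⟨y - w, by module⟩
  -- The subgradient at `w + u` is `swap w - u`, so Fenchel–Young becomes an equality there.
  have hconj : ConjugateLE G (swap (w - swap u))
      ((swap w - u) ⬝ᵥ (w + u) - r) := by
    intro v s hs
    have h := hyr v s hs
    have e : w + swap w - (w + u) = swap w - u := by module
    rw [e, dotProduct_sub] at h
    rw [swap_sub, swap_swap, dotProduct_comm]
    linarith
  -- For `y = w + u` and `z = w - swap u`, the difference `u + swap u` is fixed by `swap`, so both
  -- estimates behind `lePsi_dual` are equalities.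
  have hv : ∀ t, LEPsi G (w + (1 / 2 : R) • (u - swap u)) t →
      t ≤ dual (w + (1 / 2 : R) • (u - swap u)) := by
    intro t ht
    have h := ht (w + u) (w - swap u) _ _ (by module) hy hconj
    have e : w + u - (w - swap u) = u + swap u := by module
    rw [kappa, e] at h
    rw [dual_add, dual_smul, dual_sub, swap_smul, swap_sub, swap_swap, dotProduct_smul,
      dotProduct_sub, smul_eq_mul]
    have hd : dual (swap u) = dual u := by
      have h1 := dotProduct_swap_self (swap u)
      rw [swap_swap, swap_dotProduct, dotProduct_swap_self] at h1
      linarith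
    rw [hd]
    simp only [add_dotProduct, sub_dotProduct, dotProduct_add, swap_dotProduct,
      swap_swap, dotProduct_swap_self, dotProduct_comm u w] at h ⊢
    linarith
  have hpos := hw _ hv
  have e : w - (w + (1 / 2 : R) • (u - swap u)) = (-(1 / 2) : R) • (u - swap u) := by module
  have h0 : 2 * dual (u - swap u) = - ((u - swap u) ⬝ᵥ (u - swap u)) := by
    rw [← dotProduct_swap_self, swap_sub, swap_swap, ← dotProduct_neg, neg_sub]
  rw [e, dual_smul] at hpos
  have hz : u - swap u = 0 := eq_zero_of_dotProduct_self_nonpos (by linarith)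
  rwa [hz, smul_zero, add_zero] at hv

end Proximal

/-! ### The map represented by the proximal average -/

section Represented

variable {R : Type w} {n : ℕ}

theorem mem_graph {T : (Fin n → R) → Set (Fin n → R)} {x x' : Fin n → R} :
    Sum.elim x x' ∈ graph T ↔ x' ∈ T x :=
  Iff.rfl

variable {T : (Fin n → R) → Set (Fin n → R)}

theorem graph_nonempty (hT : ¬ IsTrivial T) : (graph T).Nonempty := by
  rw [IsTrivial, not_forall] at hT
  obtain ⟨x, hx⟩ := hT
  obtain ⟨x', hx'⟩ := Set.nonempty_iff_ne_empty.2 hx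
  exact ⟨Sum.elim x x', hx'⟩

variable [Field R] [LinearOrder R]

theorem dual_sub_nonneg_of_isMonotone (hmon : IsMonotone T) :
    ∀ a ∈ graph T, ∀ b ∈ graph T, 0 ≤ dual (a - b) :=
  fun a ha b hb => hmon (a ∘ Sum.inl) (a ∘ Sum.inr) ha (b ∘ Sum.inl) (b ∘ Sum.inr) hb

theorem toExt_mem_upperBounds_fitzpatrickTerms {v : Fin n ⊕ Fin n → R} {r : R} :
    toExt r ∈ upperBounds (fitzpatrickTerms T v) ↔ FitzpatrickLE (graph T) v r := by
  have key : ∀ a : Fin n ⊕ Fin n → R, v ⬝ᵥ swap a - dual a =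
      (v ∘ Sum.inl) ⬝ᵥ (a ∘ Sum.inr) + (a ∘ Sum.inl) ⬝ᵥ (v ∘ Sum.inr) -
        (a ∘ Sum.inl) ⬝ᵥ (a ∘ Sum.inr) := by
    intro a
    rw [dotProduct_eq_add, dotProduct_comm (a ∘ Sum.inl) (v ∘ Sum.inr)]
    rfl
  constructor
  · intro h a ha
    rw [key]
    exact toExt_le_toExt.1 (h ⟨a ∘ Sum.inl, a ∘ Sum.inr, ha, rfl⟩)
  · rintro h _ ⟨a, a', ha, rfl⟩
    have := h (Sum.elim a a') ha
    rw [key] at this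
    exact toExt_le_toExt.2 this

variable [IsStrictOrderedRing R]

variable {L : FirstOrder.Language.{u, v}} [L.Structure R]

section

variable (hL : IsOrderedFieldExpansion L R) (hR : DefinablyComplete L R)
  (hdef : IsDefinableMap L T)
include hL hR hdef

theorem isLUB_fitzpatrick (v : Fin n ⊕ Fin n → R) :
    IsLUB (fitzpatrickTerms T v) (fitzpatrick T v) := by
  refine isLUB_supExt (exists_isLUB_of_definable hL hR _ ?_)
  simp only [toExt_mem_upperBounds_fitzpatrickTerms]
  exact definable_fitzpatrickLE (F := fun (_ : Fin 1 → R) => v) (f := fun x => x 0) hL hdef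
    (fun _ => definableFun_const _) (.proj L)

theorem fitzpatrick_le_iff {v : Fin n ⊕ Fin n → R} {r : R} :
    fitzpatrick T v ≤ toExt r ↔ FitzpatrickLE (graph T) v r := by
  rw [isLUB_le_iff (isLUB_fitzpatrick hL hR hdef v), toExt_mem_upperBounds_fitzpatrickTerms]

theorem toExt_mem_upperBounds_conjugateTerms {y : Fin n ⊕ Fin n → R} {r : R} :
    toExt r ∈ upperBounds (conjugateTerms (fitzpatrick T) y) ↔ ConjugateLE (graph T) y r := by
  rw [conjugateTerms, mem_upperBounds, Set.forall_mem_range]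
  simp only [subExt_le_toExt_iff, fitzpatrick_le_iff hL hR hdef]
  rfl

theorem isLUB_conjugate (y : Fin n ⊕ Fin n → R) :
    IsLUB (conjugateTerms (fitzpatrick T) y) (conjugate (fitzpatrick T) y) := by
  refine isLUB_supExt (exists_isLUB_of_definable hL hR _ ?_)
  simp only [toExt_mem_upperBounds_conjugateTerms hL hR hdef]
  exact definable_conjugateLE (F := fun (_ : Fin 1 → R) => y) (f := fun x => x 0) hL hdef
    (fun _ => definableFun_const _) (.proj L)

theorem conjugate_le_iff {y : Fin n ⊕ Fin n → R} {r : R} :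
    conjugate (fitzpatrick T) y ≤ toExt r ↔ ConjugateLE (graph T) y r := by
  rw [isLUB_le_iff (isLUB_conjugate hL hR hdef y),
    toExt_mem_upperBounds_conjugateTerms hL hR hdef]

variable (hT : ¬ IsTrivial T) (hmon : IsMonotone T)
include hT

/-- With `conjugate_ne_bot`, this rules out `⊥ + ⊤` in the proximal average. -/
theorem fitzpatrick_ne_bot (v : Fin n ⊕ Fin n → R) : fitzpatrick T v ≠ ⊥ := by
  obtain ⟨a, ha⟩ := graph_nonempty hT
  intro h
  have := (fitzpatrick_le_iff hL hR hdef (r := v ⬝ᵥ swap a - dual a - 1)).1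
    (h ▸ bot_le) a ha
  linarith

include hmon

theorem conjugate_ne_bot (y : Fin n ⊕ Fin n → R) : conjugate (fitzpatrick T) y ≠ ⊥ := by
  obtain ⟨a, ha⟩ := graph_nonempty hT
  intro h
  have := (conjugate_le_iff hL hR hdef (r := a ⬝ᵥ y - dual a - 1)).1
    (h ▸ bot_le) a _ (fitzpatrickLE_dual (dual_sub_nonneg_of_isMonotone hmon) ha)
  linarith

theorem toExt_mem_lowerBounds_proximalTerms {v : Fin n ⊕ Fin n → R} {r : R} :
    toExt r ∈ lowerBounds
      (proximalTerms (fitzpatrick T) (transpose (conjugate (fitzpatrick T))) v) ↔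
      LEPsi (graph T) v r := by
  have key : ∀ y z, toExt r ≤ scaleExt (1 / 2) (fitzpatrick T y) +
      scaleExt (1 / 2) (transpose (conjugate (fitzpatrick T)) z) + toExt (1 / 4 * kappa y z) ↔
      ∀ a b, FitzpatrickLE (graph T) y a → ConjugateLE (graph T) (swap z) b →
        r ≤ 1 / 2 * a + 1 / 2 * b + 1 / 4 * kappa y z := by
    intro y z
    change toExt r ≤ scaleExt (1 / 2) (fitzpatrick T y) +
      scaleExt (1 / 2) (conjugate (fitzpatrick T) (swap z)) + toExt (1 / 4 * kappa y z) ↔ _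
    rw [toExt_le_scaleExt_add_iff (fitzpatrick_ne_bot hL hR hdef hT _)
      (conjugate_ne_bot hL hR hdef hT hmon _)]
    simp only [fitzpatrick_le_iff hL hR hdef, conjugate_le_iff hL hR hdef]
  constructor
  · exact fun h y z a b hyz ha hb => (key y z).1 (h ⟨y, z, hyz, rfl⟩) a b ha hb
  · rintro h _ ⟨y, z, hyz, rfl⟩
    exact (key y z).2 fun a b ha hb => h y z a b hyz ha hb

theorem isGLB_psi (v : Fin n ⊕ Fin n → R) :
    IsGLB (proximalTerms (fitzpatrick T) (transpose (conjugate (fitzpatrick T))) v)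
      (psi T v) := by
  refine isGLB_infExt (exists_isGLB_of_definable hR _ ?_)
  simp only [toExt_mem_lowerBounds_proximalTerms hL hR hdef hT hmon]
  exact definable_lePsi (F := fun (_ : Fin 1 → R) => v) (f := fun x => x 0) hL hdef
    (fun _ => definableFun_const _) (.proj L)

/-- Only `Ψ_T ≤ dual` has to be required, the other inequality being `lePsi_dual`. -/
theorem mem_graph_representedBy_psi {v : Fin n ⊕ Fin n → R} :
    v ∈ graph (representedBy (psi T)) ↔ ∀ r, LEPsi (graph T) v r → r ≤ dual v := by
  have h : v ∈ graph (representedBy (psi T)) ↔ psi T v = toExt (dual v) := by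
    change psi T (Sum.elim (v ∘ Sum.inl) (v ∘ Sum.inr)) = _ ↔ _
    rw [Sum.elim_comp_inl_inr]
    rfl
  rw [h, Ext.ext_iff_ge]
  simp only [le_isGLB_iff (isGLB_psi hL hR hdef hT hmon v), toExt_le_toExt,
    toExt_mem_lowerBounds_proximalTerms hL hR hdef hT hmon]
  exact ⟨fun h r => (h r).1, fun h r => ⟨h r, (lePsi_dual v).mono⟩⟩

end

end Represented

end DefinableConvex

theorem mainTheorem5
    (L : FirstOrder.Language.{u, v}) (R : Type w)
    [Field R] [LinearOrder R] [IsStrictOrderedRing R] [L.Structure R]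
    (hL : DefinableConvex.IsOrderedFieldExpansion L R)
    (hR : DefinableConvex.DefinablyComplete L R)
    (n : ℕ) (T : (Fin n → R) → Set (Fin n → R))
    (hT : ¬ DefinableConvex.IsTrivial T)
    (hdef : DefinableConvex.IsDefinableMap L T)
    (hmon : DefinableConvex.IsMonotone T) :
    -- the suprema and infima that define `Φ_T`, its conjugate and `Ψ_T` exist
    ((∀ v, IsLUB (DefinableConvex.fitzpatrickTerms T v) (DefinableConvex.fitzpatrick T v)) ∧
      (∀ v, IsLUB (DefinableConvex.conjugateTerms (DefinableConvex.fitzpatrick T) v)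
        (DefinableConvex.conjugate (DefinableConvex.fitzpatrick T) v)) ∧
      (∀ v, IsGLB
        (DefinableConvex.proximalTerms (DefinableConvex.fitzpatrick T)
          (DefinableConvex.transpose (DefinableConvex.conjugate (DefinableConvex.fitzpatrick T))) v)
        (DefinableConvex.psi T v))) ∧
    -- the map represented by `Ψ_T` is a definable maximal monotone extension of `T`
    DefinableConvex.IsDefinableMap L (DefinableConvex.representedBy (DefinableConvex.psi T)) ∧
    DefinableConvex.IsMaximalMonotone (DefinableConvex.representedBy (DefinableConvex.psi T)) ∧
    DefinableConvex.Extends (DefinableConvex.representedBy (DefinableConvex.psi T)) T := by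
  open DefinableConvex in
  have hmem : ∀ {v : Fin n ⊕ Fin n → R}, v ∈ graph (representedBy (psi T)) ↔
      ∀ r, LEPsi (graph T) v r → r ≤ dual v :=
    mem_graph_representedBy_psi hL hR hdef hT hmon
  have hG := dual_sub_nonneg_of_isMonotone hmon
  refine ⟨⟨isLUB_fitzpatrick hL hR hdef, isLUB_conjugate hL hR hdef,
    isGLB_psi hL hR hdef hT hmon⟩, ?_, ⟨?_, ?_⟩, ?_⟩
  · rw [IsDefinableMap, show graph (representedBy (psi T)) =
      {v | ∀ r, LEPsi (graph T) v r → r ≤ dual v} from Set.ext fun v => hmem]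
    exact definable_forall_elem (definable_imp
      (definable_lePsi hL hdef (definableMap_proj _) (.proj L))
      (hL.definable_le (.proj L) (hL.definableFun_dotProduct
        (definableMap_proj fun i => Sum.inl (Sum.inl i))
        (definableMap_proj fun i => Sum.inl (Sum.inr i)))))
  · exact fun x x' hx y y' hy => dual_sub_nonneg_of_lePsi (hmem.1 (mem_graph.2 hx))
      (hmem.1 (mem_graph.2 hy))
  · exact fun x x' hx => mem_graph.1 (hmem.2 (mem_of_monotonicallyRelated hL hR hdef
      (graph_nonempty hT) hG fun v hv => hx (v ∘ Sum.inl) (v ∘ Sum.inr) (hmem.2 hv)))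
  · exact fun v hv => hmem.2 fun r hr => lePsi_le_dual_of_mem hG hv hr
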